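/- Let $p$ be a prime, $t,m\ge 1$ and $1\le h\le r$ integers, and $n:=4t(m-1)+1$. Let $H_1,\dots,H_n\le\mathbb F_p^r$ be subspaces of dimension $h$ that are $m$-generating, i.e. $\mathrm{span}\{H_{i_1},\dots,H_{i_m}\}=\mathbb F_p^r$ for all $1\le i_1<\dots<i_m\le n$, and for each $i$ let $x_{1,i},\dots,x_{r-h,i}\in\mathbb F_p^r$ satisfy $\mathrm{span}\{H_i,x_{1,i},\dots,x_{r-h,i}\}=\mathbb F_p^r$. Let $K:=\{0\}\cup\{2^l:0\le l\le k\}\subseteq\mathbb F_p$ with $k$ minimal such that $2^k\ge p/3$, and let $$\Gamma_2:=\bigcup_i\bigl(H_i+(\{0\}\cup\{a\,x_{l,i}:a\in K,\ 1\le l\le r-h\})\bigr).$$ Write $\omega_p=e^{2\pi i/p}$. For a finite abelian group $G$ and $f:G\to\mathbb C$ put $\widehat f(\chi)=\frac1{|G|}\sum_{x\in G}f(x)\chi(x)^{-1}$ for $\chi\in\widehat G$. For $f:\mathbb F_p^r\to\mathbb C$, $1\le j\le n$ and $v\in\mathbb F_p^r$ let $c_{j,v}$ be the Fourier transform on $H_j$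 of $y\mapsto f(v+y)$, viewed as a function of the cosets $\chi H_j^\perp$, where $H_j^\perp=\{\chi\in\widehat{\mathbb F_p^r}:\chi|_{H_j}=1\}$ and the coset $\chi H_j^\perp$ is identified with $\chi|_{H_j}\in\widehat{H_j}$. *1-sparse procedure.* Given the values on $K$ of a function $u:\mathbb F_p\to\mathbb C$, put $b(2^l):=\arg(u(2^l)/u(0))$ for $0\le l\le k$ ($b(2^l):=0$ if $u(2^l)$ or $u(0)$ is $0$), and return the index $y\in\{0,\dots,p-1\}$ such that the distance of $p\,b(2^l)/(2\pi)-2^ly$ to $p\mathbb Z$ is less than $p/6$ for all $0\le l\le k$; return $0$ if there is none. Consider the following algorithm, which uses only the values $f|_{\Gamma_2}$; in both selections of largest values ties are broken arbitrarily, and everything is selected if there are too few elements. 1. Start with all counters $Y(\chi)=0$, $\chi\in\widehat{\mathbb F_p^r}$, and an empty list $Z$. For $j=1,\dots,n$ and for $2t-1$ cosets $C$ of $H_j^\perp$ for which $|c_{j,0}(C)|$ is largest: for each $1\le l\le r-h$ let $b_l$ be the result of the 1-sparse procedure for $a\mapsto c_{j,a x_{l,j}}(C)$; let $\chi$ be the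 unique character in $C$ with $\chi(x_{l,j})=\omega_p^{b_l}$ for all $l$; increase $Y(\chi)$ by $1$; if then $Y(\chi)=2t(\lceil r/h\rceil-1)+1$, append $\chi$ to $Z$. 2. For $\chi\in Z$ put $\widehat f''(\chi):=\mathrm{Median}_{j}\,\Re\, c_{j,0}(\chi H_j^\perp)+i\,\mathrm{Median}_{j}\,\Im\, c_{j,0}(\chi H_j^\perp)$ with $1\le j\le n$; put $\widehat f''(\chi):=0$ for all other $\chi$. 3. For $t$ characters $\chi$ for which $|\widehat f''(\chi)|$ is largest put $\widehat f'(\chi):=\widehat f''(\chi)$; put $\widehat f'(\chi):=0$ for all other $\chi$. Return $\widehat f'$. Then for every $f:\mathbb F_p^r\to\mathbb C$ the algorithm returns a function $\widehat f'$, and every function $\widehat f'$ that it can return satisfies $|\mathrm{supp}(\widehat f')|\le t$ and $$\|\widehat f-\widehat f'\|_1\le(1+3\sqrt2)\,\|\epsilon\|_1$$ for all $g,\epsilon:\widehat{\mathbb F_p^r}\to\mathbb C$ with $\widehat f=g+\epsilon$ and $|\mathrm{supp}(g)|\le t$. -/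

import Mathlib

open scoped Pointwise

noncomputable section

namespace FourierSampling

/-- The vector space `𝔽_p^r`. -/
abbrev Vec (p r : ℕ) : Type := Fin r → ZMod p

/-- The Fourier transform of a function on a finite abelian group `G`, as a function on the
characters of `G`:  `f̂(χ) = |G|⁻¹ ∑ x, f x * χ(x)⁻¹`,  so that `f = ∑ χ, f̂(χ) χ`. -/
def fourier {G : Type*} [AddCommGroup G] [Fintype G] (f : G → ℂ) (χ : AddChar G ℂ) : ℂ :=
  (Fintype.card G : ℂ)⁻¹ * ∑ x, f x * (χ x)⁻¹

/-- The subspaces `H_1, …, H_n` are `m`-generating: any `m` of them (with distinct indices)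
span the whole space. -/
def IsGenerating {p r n : ℕ} (m : ℕ) (H : Fin n → Submodule (ZMod p) (Vec p r)) : Prop :=
  ∀ I : Finset (Fin n), I.card = m → (⨆ i ∈ I, H i) = ⊤

/-! ### The 1-sparse procedure on `𝔽_p` -/

/-- The minimal `k` with `2 ^ k ≥ p / 3`  (for `p ≥ 2` it is the same to minimise over the
integers, because `2⁻¹ < p / 3`). -/
def kMax (p : ℕ) : ℕ := sInf {k : ℕ | (p : ℝ) / 3 ≤ 2 ^ k}

/-- `K = {0} ∪ {2 ^ i : 0 ≤ i ≤ k} ⊆ 𝔽_p`. -/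
def sampleK (p : ℕ) : Set (ZMod p) := {0} ∪ {a | ∃ i : ℕ, i ≤ kMax p ∧ a = 2 ^ i}

theorem zero_mem_sampleK (p : ℕ) : (0 : ZMod p) ∈ sampleK p := Or.inl rfl

theorem two_pow_mem_sampleK (p : ℕ) (l : Fin (kMax p + 1)) :
    (2 : ZMod p) ^ (l : ℕ) ∈ sampleK p :=
  Or.inr ⟨l, Nat.lt_succ_iff.mp l.2, rfl⟩

/-- `|x|_d`, the distance of the real number `x` to the set `d ℤ`. -/
def distMul (d x : ℝ) : ℝ := Metric.infDist x (Set.range fun z : ℤ => d * (z : ℝ))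

open Classical in
/-- `b(2^l) = arg (f(2^l) / f(0))`, and `0` if one of the two values vanishes. -/
def phase {p : ℕ} (f : sampleK p → ℂ) (l : Fin (kMax p + 1)) : ℝ :=
  if f ⟨2 ^ (l : ℕ), two_pow_mem_sampleK p l⟩ = 0 ∨ f ⟨0, zero_mem_sampleK p⟩ = 0 then 0
  else Complex.arg (f ⟨2 ^ (l : ℕ), two_pow_mem_sampleK p l⟩ / f ⟨0, zero_mem_sampleK p⟩)

open Classical in
/-- The vector of marks `e(0), …, e(p-1)` after the double loop over `l` and `j`: starting from
`0`, the entry `e(j)` is set to `1` as soon as `|p b(2^l) / (2π) - 2^l j|_p ≥ p / 6`. -/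
def marks {p : ℕ} (f : sampleK p → ℂ) : ℕ → ℕ :=
  (List.finRange (kMax p + 1)).foldl
    (fun e l => (List.range p).foldl
      (fun e j =>
        if e j = 0 ∧ (p : ℝ) / 6 ≤
            distMul p ((p : ℝ) * phase f l / (2 * Real.pi) - 2 ^ (l : ℕ) * (j : ℝ))
        then Function.update e j 1 else e) e)
    (fun _ => 0)

/-- The 1-sparse procedure, run on the values of a function on `K`: it returns the (first)
unmarked index in `{0, …, p-1}`, and `0` if there is none. -/
def oneSparse {p : ℕ} (f : sampleK p → ℂ) : ZMod p :=
  ((((List.range p).find? fun j => marks f j = 0).getD 0 : ℕ) : ZMod p)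

/-! ### The sampling set -/

/-- The shifts of one subspace with directions `x_1, …, x_d`: the vectors `k x_l` with `k ∈ K`.
Since `0 ∈ K`, adding `0` explicitly only matters if there are no directions (`d = 0`). -/
def shifts {p r d : ℕ} (x : Fin d → Vec p r) : Set (Vec p r) :=
  {0} ∪ {v | ∃ k ∈ sampleK p, ∃ l : Fin d, v = k • x l}

/-- The sampling set `Γ₂ = ⋃ i, (H_i + {k x_{l,i}})`. -/
def Gamma2 {p r n d : ℕ} (H : Fin n → Submodule (ZMod p) (Vec p r))
    (x : Fin n → Fin d → Vec p r) : Set (Vec p r) :=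
  ⋃ i, ((H i : Set (Vec p r)) + shifts (x i))

theorem zero_mem_shifts {p r d : ℕ} (x : Fin d → Vec p r) : (0 : Vec p r) ∈ shifts x :=
  Or.inl rfl

theorem smul_mem_shifts {p r d : ℕ} (x : Fin d → Vec p r) (k : sampleK p) (l : Fin d) :
    (k : ZMod p) • x l ∈ shifts x :=
  Or.inr ⟨k, k.2, l, rfl⟩

theorem shift_add_mem_Gamma2 {p r n d : ℕ} (H : Fin n → Submodule (ZMod p) (Vec p r))
    (x : Fin n → Fin d → Vec p r) (j : Fin n) (v : shifts (x j)) (y : H j) :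
    (v : Vec p r) + (y : Vec p r) ∈ Gamma2 H x := by
  rw [add_comm]
  exact Set.mem_iUnion.mpr ⟨j, Set.add_mem_add y.2 v.2⟩

/-! ### The reconstruction algorithm

The cosets `χ_w H^⊥` of the annihilator of a subspace `H` are identified with the characters of
`H`: the coset `χ_w H^⊥` is the set of all characters that have the same restriction to `H` as
`χ_w`. -/

open Classical in
/-- `c_{j,v}`, the Fourier transform on `H_j` of `y ↦ f (v + y)`; it is computed from the
samples `s = f|_{Γ₂}` alone. -/
def coeff {p r n d : ℕ} [Fact p.Prime] (H : Fin n → Submodule (ZMod p) (Vec p r))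
    (x : Fin n → Fin d → Vec p r) (s : Gamma2 H x → ℂ) (j : Fin n) (v : shifts (x j)) :
    AddChar (H j) ℂ → ℂ :=
  fourier fun y : H j => s ⟨(v : Vec p r) + (y : Vec p r), shift_add_mem_Gamma2 H x j v y⟩

/-- `c_{j,0}`. -/
def coeffZero {p r n d : ℕ} [Fact p.Prime] (H : Fin n → Submodule (ZMod p) (Vec p r))
    (x : Fin n → Fin d → Vec p r) (s : Gamma2 H x → ℂ) (j : Fin n) : AddChar (H j) ℂ → ℂ :=
  coeff H x s j ⟨0, zero_mem_shifts (x j)⟩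

/-- The restriction to a subspace `H` of a character of `𝔽_p^r`; it stands for `χ H^⊥`. -/
def restrict {p r : ℕ} (H : Submodule (ZMod p) (Vec p r)) (χ : AddChar (Vec p r) ℂ) :
    AddChar H ℂ :=
  χ.compAddMonoidHom H.subtype.toAddMonoidHom

/-- The character `χ_w` that lies in the coset of `H^⊥` given by `ψ` and, for every `l`, in the
coset of `(span {x_l})^⊥` given by `b_l ∈ 𝔽_p`, which consists of the `χ` with
`χ (a x_l) = ω_p ^ (b_l a)` for all `a`.  There is exactly one such `χ_w` if `H` and the `x_l`
decompose the whole space. -/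
def reconstruct {p r d : ℕ} [Fact p.Prime] (H : Submodule (ZMod p) (Vec p r))
    (x : Fin d → Vec p r) (ψ : AddChar H ℂ) (b : Fin d → ZMod p) : AddChar (Vec p r) ℂ :=
  Classical.epsilon fun χ =>
    restrict H χ = ψ ∧ ∀ (l : Fin d) (a : ZMod p), χ (a • x l) = ZMod.stdAddChar (b l * a)

/-- The character that the algorithm reads off from the coset `ψ` in round `j`: for each
direction `x_{l,j}` the 1-sparse procedure is run on `a ↦ c_{j, a x_{l,j}}(ψ)`, `a ∈ K`. -/
def identify {p r n d : ℕ} [Fact p.Prime] (H : Fin n → Submodule (ZMod p) (Vec p r))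
    (x : Fin n → Fin d → Vec p r) (s : Gamma2 H x → ℂ) (j : Fin n) (ψ : AddChar (H j) ℂ) :
    AddChar (Vec p r) ℂ :=
  reconstruct (H j) (x j) ψ fun l =>
    oneSparse fun a : sampleK p => coeff H x s j ⟨(a : ZMod p) • x j l, smul_mem_shifts (x j) a l⟩ ψ

/-- `L` lists, without repetition, `N` indices at which the value of `v` is largest (all indices,
if there are fewer than `N`); ties are broken in any way. -/
def IsLargest {ι : Type*} (N : ℕ) (v : ι → ℝ) (L : List ι) : Prop :=
  L.Nodup ∧ L.length = min N (Nat.card ι) ∧ ∀ i ∈ L, ∀ j, j ∉ L → v j ≤ v i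

/-- The variables of the first loop: the counters `Y` and the list `Z`. -/
structure LoopState (X : Type*) where
  Y : X → ℕ
  Z : List X

open Classical in
/-- One pass of the inner loop: `Y(χ) := Y(χ) + 1`, and `χ` is appended to `Z` if now
`Y(χ) = N`. -/
def LoopState.step {X : Type*} (N : ℕ) (S : LoopState X) (χ : X) : LoopState X where
  Y := Function.update S.Y χ (S.Y χ + 1)
  Z := if S.Y χ + 1 = N then S.Z ++ [χ] else S.Z

/-- The list `Z` after the first loop, where `sel j` are the cosets selected in round `j` and
`N` is the threshold. -/
def candidates {p r n d : ℕ} [Fact p.Prime] (N : ℕ) (H : Fin n → Submodule (ZMod p) (Vec p r))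
    (x : Fin n → Fin d → Vec p r) (s : Gamma2 H x → ℂ)
    (sel : (j : Fin n) → List (AddChar (H j) ℂ)) : List (AddChar (Vec p r) ℂ) :=
  ((List.finRange n).foldl
    (fun S j => (sel j).foldl (fun S ψ => S.step N (identify H x s j ψ)) S)
    (⟨fun _ => 0, []⟩ : LoopState (AddChar (Vec p r) ℂ))).Z

open Classical in
/-- The median of a list of reals (the mean of the two middle entries for an even length). -/
def median (L : List ℝ) : ℝ :=
  let S := L.insertionSort (· ≤ ·)
  (S.getD ((S.length - 1) / 2) 0 + S.getD (S.length / 2) 0) / 2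

/-- `Median {Re x : x ∈ X} + i Median {Im x : x ∈ X}`, `X` the list of the `c_{j,0}(χ H_j^⊥)`. -/
def estimate {p r n d : ℕ} [Fact p.Prime] (H : Fin n → Submodule (ZMod p) (Vec p r))
    (x : Fin n → Fin d → Vec p r) (s : Gamma2 H x → ℂ) (χ : AddChar (Vec p r) ℂ) : ℂ :=
  let X : List ℂ := (List.finRange n).map fun j => coeffZero H x s j (restrict (H j) χ)
  (median (X.map Complex.re) : ℂ) + Complex.I * (median (X.map Complex.im) : ℂ)

open Classical in
/-- The restriction of a function to the entries of a list, extended by `0`. -/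
def keep {X : Type*} (L : List X) (F : X → ℂ) (χ : X) : ℂ := if χ ∈ L then F χ else 0

/-- `F` is an output of the algorithm, for the parameters `t`, `h`, the subspaces `H_j` and the
directions `x_{l,j}`, on the samples `s`.  The only freedom is how ties are broken in the two
selections of largest values. -/
def IsOutput {p r n d : ℕ} [Fact p.Prime] (t h : ℕ) (H : Fin n → Submodule (ZMod p) (Vec p r))
    (x : Fin n → Fin d → Vec p r) (s : Gamma2 H x → ℂ) (F : AddChar (Vec p r) ℂ → ℂ) : Prop :=
  ∃ sel : (j : Fin n) → List (AddChar (H j) ℂ),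
    (∀ j, IsLargest (2 * t - 1) (fun ψ => ‖coeffZero H x s j ψ‖) (sel j)) ∧
    ∃ F₂ : AddChar (Vec p r) ℂ → ℂ,
      F₂ = keep (candidates (2 * t * (⌈(r : ℚ) / (h : ℚ)⌉₊ - 1) + 1) H x s sel)
        (estimate H x s) ∧
      ∃ T : List (AddChar (Vec p r) ℂ),
        IsLargest t (fun χ => ‖F₂ χ‖) T ∧ F = keep T F₂

end FourierSampling

end

/-!
Let `S` be the support of `g` and let `M` be the `ℓ¹`-mass of `f̂` off `S`; since `f̂ = ε` there,
`M ≤ ‖ε‖₁`.  The coefficient `c_{j,v}(χ H_j^⊥)` is the sum of `f̂(χ') χ'(v)` over the coset of `χ`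
(`coeff_eq_sum`), so it equals `f̂(χ) χ(v)` up to the contributions of the other elements of the
coset.  Two distinct characters share a coset in at most `m - 1` rounds
(`IsGenerating.card_restrict_eq_le`).  Hence, for every `χ`, in at most `t (m - 1)` rounds the coset
contains another element of `S`, and, as the noise summed over all rounds is at most `(m - 1) M`,
in at most `t (m - 1)` rounds the noise exceeds `M / t`.  So at most `2 t (m - 1)` of the
`n = 4 t (m - 1) + 1` rounds are bad (`card_badRounds_le`).

This one count is used twice.  More than half of the rounds are good, so the coordinatewise medians
are within `√2 M / t` of `f̂(χ)` (`norm_estimate_sub_le`).  And if `χ ∈ S` has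
`‖f̂(χ)‖ > 2 M / t`, then in each of the at least `2 t (m - 1) + 1` good rounds its coset is selected
(`restrict_mem_of_isLargest`) and the 1-sparse procedure, whose input is off by less than
`‖f̂(χ)‖ / 2`, reads off `χ` (`oneSparse_eq_of_near`, `identify_eq`); as `⌈r / h⌉ ≤ m`, its counter
reaches the threshold.

So every `χ` is either estimated within `B = √2 M / t`, or dropped, with `‖f̂(χ)‖ ≤ 2 B` if `χ ∈ S`.
Keeping the `t` largest estimates then costs at most `3 t B = 3 √2 M` on top of `M`, by playing off
the elements of `S` that are lost against the elements off `S` that are kept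
(`sum_norm_sub_keep_le`).
-/

noncomputable section

namespace FourierSampling

/-! ### The 1-sparse procedure -/

theorem foldl_mark_eq_zero (P : ℕ → Prop) [DecidablePred P] (L : List ℕ) (e : ℕ → ℕ) (i : ℕ) :
    L.foldl (fun e j => if e j = 0 ∧ P j then Function.update e j 1 else e) e i = 0 ↔
      e i = 0 ∧ ¬ (i ∈ L ∧ P i) := by
  induction L generalizing e with
  | nil => simp
  | cons j L ih =>
    rw [List.foldl_cons, ih]
    by_cases hij : i = j
    · subst hij
      by_cases h : e i = 0 ∧ P i
      · simp [h]
      · rw [if_neg h]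
        simp only [List.mem_cons, true_or, true_and]
        tauto
    · have : (if e j = 0 ∧ P j then Function.update e j 1 else e) i = e i := by
        split_ifs
        · exact Function.update_of_ne hij _ _
        · rfl
      rw [this]
      simp [hij]

/-- An entry stays unmarked exactly if no test of the double loop rejects it. -/
theorem foldl_foldl_mark_eq_zero {α : Type*} (p : ℕ) (P : α → ℕ → Prop)
    [∀ l, DecidablePred (P l)] (L : List α) (e : ℕ → ℕ) (i : ℕ) :
    L.foldl (fun e l => (List.range p).foldl
      (fun e j => if e j = 0 ∧ P l j then Function.update e j 1 else e) e) e i = 0 ↔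
      e i = 0 ∧ ∀ l ∈ L, ¬ (i < p ∧ P l i) := by
  induction L generalizing e with
  | nil => simp
  | cons l L ih =>
    rw [List.foldl_cons, ih, foldl_mark_eq_zero]
    simp only [List.mem_range, List.forall_mem_cons]
    tauto

theorem marks_eq_zero_iff {p : ℕ} (f : sampleK p → ℂ) {i : ℕ} (hi : i < p) :
    marks f i = 0 ↔ ∀ l, distMul p ((p : ℝ) * phase f l / (2 * Real.pi) - 2 ^ (l : ℕ) * (i : ℝ))
      < (p : ℝ) / 6 := by
  unfold marks
  rw [foldl_foldl_mark_eq_zero p (fun l j => (p : ℝ) / 6 ≤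
    distMul p ((p : ℝ) * phase f l / (2 * Real.pi) - 2 ^ (l : ℕ) * (j : ℝ)))]
  simp [hi]

theorem distMul_lt_iff (d x c : ℝ) : distMul d x < c ↔ ∃ z : ℤ, |x - d * z| < c := by
  unfold distMul
  rw [Metric.infDist_lt_iff (Set.range_nonempty _)]
  simp [Real.dist_eq]

/-- The dyadic multiples up to `2 ^ kMax p` reach a third of `p`. -/
theorem div_three_le_two_pow_kMax (p : ℕ) : (p : ℝ) / 3 ≤ 2 ^ kMax p := by
  have hne : {k : ℕ | (p : ℝ) / 3 ≤ 2 ^ k}.Nonempty := by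
    obtain ⟨k, hk⟩ := pow_unbounded_of_one_lt ((p : ℝ) / 3) (one_lt_two)
    exact ⟨k, hk.le⟩
  exact Nat.sInf_mem hne

/-- An integer whose dyadic multiples `2 ^ l * d`, `l ≤ kMax p`, all lie within `p / 3` of `p ℤ` is
itself a multiple of `p`: its least absolute residue doubles at every step without wrapping
around, and so would exceed `p / 3` at `l = kMax p` unless it is `0`. -/
theorem dvd_of_forall_two_pow_near {p : ℕ} (hp : 0 < p) (d : ℤ)
    (h : ∀ l ≤ kMax p, ∃ z : ℤ, |(2 : ℝ) ^ l * d - p * z| < p / 3) : (p : ℤ) ∣ d := by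
  have hp' : (0 : ℝ) < p := by exact_mod_cast hp
  obtain ⟨z₀, hz₀⟩ := h 0 (Nat.zero_le _)
  have key : ∀ l ≤ kMax p, |(2 : ℝ) ^ l * (d - p * z₀)| < p / 3 := by
    intro l
    induction l with
    | zero => intro _; simpa using hz₀
    | succ l ih =>
      intro hl
      have h1 := ih (by omega)
      obtain ⟨w, hw⟩ := h (l + 1) hl
      have h2 : (p : ℝ) * |(w - 2 ^ (l + 1) * z₀ : ℝ)| < p * 1 := by
        rw [← abs_of_pos hp', ← abs_mul, abs_of_pos hp']
        rw [abs_lt] at *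
        rw [pow_succ] at *
        constructor <;> linarith
      -- The multiple of `p` near `2 ^ (l + 1) * d` is `2 ^ (l + 1) * (p * z₀)`: no wrap-around.
      have h3 : |(w - 2 ^ (l + 1) * z₀ : ℤ)| < 1 := by
        have := lt_of_mul_lt_mul_left h2 hp'.le
        exact_mod_cast this
      have h4 : (w : ℝ) = 2 ^ (l + 1) * z₀ := by
        exact_mod_cast sub_eq_zero.mp (Int.abs_lt_one_iff.mp h3)
      rw [h4] at hw
      convert hw using 2
      ring
  have h1 := key _ le_rfl
  have h2 := div_three_le_two_pow_kMax p
  rw [abs_mul, abs_of_pos (by positivity)] at h1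
  have h3 : |(d - p * z₀ : ℝ)| < 1 := by
    by_contra! hc
    have : (2 : ℝ) ^ kMax p * 1 ≤ 2 ^ kMax p * |(d - p * z₀ : ℝ)| := by gcongr
    linarith
  have h4 : |(d - p * z₀ : ℤ)| < 1 := by exact_mod_cast h3
  exact ⟨z₀, sub_eq_zero.mp (Int.abs_lt_one_iff.mp h4)⟩

/-- If the index `b` passes all tests, then the procedure returns it, because two indices passing
all tests differ by a multiple of `p`. -/
theorem oneSparse_eq_of_forall_lt {p : ℕ} [NeZero p] (f : sampleK p → ℂ) (b : ZMod p)
    (h : ∀ l, distMul p ((p : ℝ) * phase f l / (2 * Real.pi) - 2 ^ (l : ℕ) * (b.val : ℝ))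
      < (p : ℝ) / 6) : oneSparse f = b := by
  have hb : b.val < p := ZMod.val_lt b
  have hp : 0 < p := Nat.pos_of_neZero p
  unfold oneSparse
  rcases hfind : (List.range p).find? (fun j => marks f j = 0) with _ | i
  · rw [List.find?_eq_none] at hfind
    exact absurd ((marks_eq_zero_iff f hb).2 h) (by simpa using hfind b.val (List.mem_range.2 hb))
  · have hi : i < p := List.mem_range.1 (List.mem_of_find?_eq_some hfind)
    have hmi : marks f i = 0 := by simpa using List.find?_some hfind
    rw [marks_eq_zero_iff f hi] at hmi
    have hd : (p : ℤ) ∣ (i : ℤ) - b.val := by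
      refine dvd_of_forall_two_pow_near hp _ fun l hl => ?_
      obtain ⟨z, hz⟩ := (distMul_lt_iff _ _ _).1 (h ⟨l, Nat.lt_succ_of_le hl⟩)
      obtain ⟨w, hw⟩ := (distMul_lt_iff _ _ _).1 (hmi ⟨l, Nat.lt_succ_of_le hl⟩)
      refine ⟨z - w, ?_⟩
      push_cast
      rw [abs_lt] at *
      constructor <;> dsimp only at * <;> linarith
    have : ((i : ℤ) : ZMod p) = ((b.val : ℤ) : ZMod p) :=
      ((ZMod.intCast_eq_intCast_iff_dvd_sub _ _ _).2 hd).symm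
    simpa using this

/-- A relative error below `1 / 2` turns a complex number by less than `π / 6`. -/
theorem abs_arg_one_add_lt {δ : ℂ} (h : ‖δ‖ < 1 / 2) : |Complex.arg (1 + δ)| < Real.pi / 6 := by
  have hsq : δ.re ^ 2 + δ.im ^ 2 < 1 / 4 := by
    have h1 : ‖δ‖ ^ 2 < (1 / 2) ^ 2 := by gcongr
    rw [Complex.sq_norm, Complex.normSq_apply] at h1
    nlinarith
  have hre : 0 < 1 + δ.re := by nlinarith [sq_nonneg δ.im]
  have hne : (1 + δ : ℂ) ≠ 0 := fun h0 => by
    have := congrArg Complex.re h0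
    simp at this
    linarith
  have hpos : 0 < ‖1 + δ‖ := norm_pos_iff.2 hne
  have hlt : |δ.im| < ‖1 + δ‖ / 2 := by
    have h2 : ‖1 + δ‖ ^ 2 = (1 + δ.re) ^ 2 + δ.im ^ 2 := by
      rw [Complex.sq_norm, Complex.normSq_apply]
      simp
      ring
    refine abs_lt_of_sq_lt_sq ?_ (by positivity)
    nlinarith [sq_nonneg (2 * δ.re + 1 / 2)]
  rw [Complex.arg_of_re_nonneg (by simpa using hre.le)]
  have hπ := Real.pi_pos
  have him : (1 + δ).im = δ.im := by simp
  rw [him, abs_lt] at *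
  constructor
  · rw [Real.lt_arcsin_iff_sin_lt' ⟨by linarith, by linarith⟩, Real.sin_neg, Real.sin_pi_div_six,
      lt_div_iff₀ hpos]
    linarith
  · rw [Real.arcsin_lt_iff_lt_sin' ⟨by linarith, by linarith⟩, Real.sin_pi_div_six,
      div_lt_iff₀ hpos]
    linarith

/-- If `u ≈ a` and `v ≈ a exp(i θ)` with errors below `‖a‖ / 2`, then the phase of `v / u` is `θ` up
to less than `π / 3`, modulo `2 π`. -/
theorem arg_div_near {a u v : ℂ} {θ : ℝ} (hu : ‖u - a‖ < ‖a‖ / 2)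
    (hv : ‖v - a * Complex.exp (θ * Complex.I)‖ < ‖a‖ / 2) :
    u ≠ 0 ∧ v ≠ 0 ∧ ∃ z : ℤ, |Complex.arg (v / u) - θ - 2 * Real.pi * z| < Real.pi / 3 := by
  have ha : 0 < ‖a‖ := by linarith [norm_nonneg (u - a)]
  have ha0 : a ≠ 0 := norm_pos_iff.1 ha
  set w := Complex.exp (θ * Complex.I) with hw
  have hw0 : w ≠ 0 := Complex.exp_ne_zero _
  have hw1 : ‖w‖ = 1 := Complex.norm_exp_ofReal_mul_I θ
  have hδ : ∀ (c y : ℂ), ‖c‖ = ‖a‖ → ‖y - c‖ < ‖a‖ / 2 → y ≠ 0 ∧ y = c * (1 + (y - c) / c) ∧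
      |Complex.arg (1 + (y - c) / c)| < Real.pi / 6 ∧ 1 + (y - c) / c ≠ 0 := by
    intro c y hc hy
    have hc0 : c ≠ 0 := by rw [← norm_pos_iff, hc]; exact ha
    have hy0 : y ≠ 0 := by
      rintro rfl
      rw [zero_sub, norm_neg, hc] at hy
      linarith
    have heq : y = c * (1 + (y - c) / c) := by field_simp; ring
    refine ⟨hy0, heq, abs_arg_one_add_lt ?_, fun h => hy0 ?_⟩
    · rw [norm_div, div_lt_iff₀ (by rw [hc]; exact ha), hc]
      linarith
    · rw [heq, h, mul_zero]
  obtain ⟨hu0, hu1, hu2, hu3⟩ := hδ a u rfl hu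
  obtain ⟨hv0, hv1, hv2, hv3⟩ := hδ (a * w) v (by rw [norm_mul, hw1, mul_one]) hv
  refine ⟨hu0, hv0, ?_⟩
  set δu := 1 + (u - a) / a
  set δv := 1 + (v - a * w) / (a * w)
  have hargw : (Complex.arg w : Real.Angle) = (θ : Real.Angle) := by
    have h1 := Complex.arg_cos_add_sin_mul_I_coe_angle (θ : Real.Angle)
    rw [Real.Angle.cos_coe, Real.Angle.sin_coe, Complex.ofReal_cos, Complex.ofReal_sin,
      ← Complex.exp_mul_I] at h1
    exact h1
  have key : (Complex.arg (v / u) : Real.Angle) =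
      ((θ + (Complex.arg δv - Complex.arg δu) : ℝ) : Real.Angle) := by
    rw [Complex.arg_div_coe_angle hv0 hu0, hv1, hu1,
      Complex.arg_mul_coe_angle (mul_ne_zero ha0 hw0) hv3, Complex.arg_mul_coe_angle ha0 hw0,
      Complex.arg_mul_coe_angle ha0 hu3, hargw]
    rw [Real.Angle.coe_add, Real.Angle.coe_sub]
    abel
  obtain ⟨z, hz⟩ := Real.Angle.angle_eq_iff_two_pi_dvd_sub.1 key
  refine ⟨z, ?_⟩
  have : Complex.arg (v / u) - θ - 2 * Real.pi * z = Complex.arg δv - Complex.arg δu := by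
    linarith
  rw [this]
  rw [abs_lt] at *
  constructor <;> linarith

/-- The 1-sparse procedure recovers the frequency `b` of `k ↦ a ω_p ^ (b k)` from samples with an
error smaller than `|a| / 2`. -/
theorem oneSparse_eq_of_near {p : ℕ} [NeZero p] (f : sampleK p → ℂ) (a : ℂ) (b : ZMod p)
    (h : ∀ k : sampleK p, ‖f k - a * ZMod.stdAddChar (b * (k : ZMod p))‖ < ‖a‖ / 2) :
    oneSparse f = b := by
  refine oneSparse_eq_of_forall_lt f b fun l => ?_
  have hp : (0 : ℝ) < p := by exact_mod_cast Nat.pos_of_neZero p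
  have hπ := Real.pi_pos
  have h0 := h ⟨0, zero_mem_sampleK p⟩
  have hl := h ⟨2 ^ (l : ℕ), two_pow_mem_sampleK p l⟩
  rw [mul_zero, AddChar.map_zero_eq_one, mul_one] at h0
  have hchar : (ZMod.stdAddChar (b * 2 ^ (l : ℕ)) : ℂ) =
      Complex.exp (((2 * Real.pi * (2 ^ (l : ℕ) * b.val) / p : ℝ) : ℂ) * Complex.I) := by
    have : b * 2 ^ (l : ℕ) = (((b.val : ℤ) * 2 ^ (l : ℕ) : ℤ) : ZMod p) := by simp
    rw [this, ZMod.stdAddChar_coe]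
    congr 1
    push_cast
    ring
  rw [hchar] at hl
  obtain ⟨hu, hv, z, hz⟩ := arg_div_near h0 hl
  have hph : phase f l = Complex.arg (f ⟨2 ^ (l : ℕ), two_pow_mem_sampleK p l⟩ /
      f ⟨0, zero_mem_sampleK p⟩) := by
    unfold phase
    exact if_neg (by simp [hu, hv])
  rw [distMul_lt_iff, hph]
  refine ⟨z, ?_⟩
  have hc : (0 : ℝ) < p / (2 * Real.pi) := by positivity
  have := mul_lt_mul_of_pos_left hz hc
  rw [← abs_of_pos hc, ← abs_mul, abs_of_pos hc] at this
  have h1 : (p : ℝ) / 6 = p / (2 * Real.pi) * (Real.pi / 3) := by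
    field_simp
    norm_num
  rw [h1]
  refine lt_of_eq_of_lt (congrArg abs ?_) this
  field_simp

/-! ### Largest values -/

theorem exists_isLargest {ι : Type*} [Finite ι] (N : ℕ) (v : ι → ℝ) :
    ∃ L : List ι, IsLargest N v L := by
  classical
  have := Fintype.ofFinite ι
  let r : ι → ι → Prop := fun a b => v b ≤ v a
  have : Std.Total r := ⟨fun a b => le_total (v b) (v a)⟩
  have : IsTrans ι r := ⟨fun a b c hab hbc => le_trans hbc hab⟩
  let L := (Finset.univ : Finset ι).toList.insertionSort r
  have hperm : L.Perm (Finset.univ : Finset ι).toList := List.perm_insertionSort r _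
  have hsplit : L.take N ++ L.drop N = L := List.take_append_drop N L
  refine ⟨L.take N, ?_, ?_, ?_⟩
  · exact (hperm.nodup_iff.2 (Finset.nodup_toList _)).sublist (List.take_sublist N L)
  · rw [List.length_take, hperm.length_eq, Finset.length_toList, Finset.card_univ,
      Nat.card_eq_fintype_card]
  · intro i hi j hj
    have hpw : List.Pairwise r L := List.pairwise_insertionSort r _
    rw [← hsplit, List.pairwise_append] at hpw
    have hjL : j ∈ L := hperm.mem_iff.2 (by simp)
    rw [← hsplit, List.mem_append] at hjL
    exact hpw.2.2 i hi j (hjL.resolve_left hj)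

theorem IsLargest.length_eq_of_notMem {ι : Type*} [Finite ι] {N : ℕ} {v : ι → ℝ} {L : List ι}
    (hL : IsLargest N v L) {i : ι} (hi : i ∉ L) : L.length = N := by
  classical
  have := Fintype.ofFinite ι
  have h1 : L.length < Nat.card ι := by
    rw [← List.toFinset_card_of_nodup hL.1, Nat.card_eq_fintype_card, ← Finset.card_univ]
    exact Finset.card_lt_card
      (Finset.ssubset_univ_iff.2 fun h => hi (by simp [← List.mem_toFinset, h]))
  have := hL.2.1
  omega

/-! ### The counters -/

/-- A counter that starts below `N` and is increased often enough takes the value `N` on its way, at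
which moment `χ` is appended. -/
theorem mem_foldl_step {X : Type*} (N : ℕ) (χ : X) (L : List X) (S : LoopState X)
    [DecidableEq X] (h : χ ∈ S.Z ∨ S.Y χ < N ∧ N ≤ S.Y χ + L.count χ) :
    χ ∈ (L.foldl (fun S ψ => S.step N ψ) S).Z := by
  induction L generalizing S with
  | nil =>
    rcases h with h | h
    · exact h
    · simp at h; omega
  | cons ψ L ih =>
    rw [List.foldl_cons]
    apply ih
    by_cases hχ : χ ∈ S.Z
    · left
      unfold LoopState.step
      dsimp only
      split_ifs <;> simp [hχ]
    obtain ⟨h1, h2⟩ := h.resolve_left hχ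
    by_cases hψ : χ = ψ
    · subst hψ
      rw [List.count_cons_self] at h2
      by_cases hN : S.Y χ + 1 = N
      · left
        simp [LoopState.step, hN]
      · right
        simp only [LoopState.step, Function.update_self]
        omega
    · right
      rw [List.count_cons_of_ne (Ne.symm hψ)] at h2
      simpa [LoopState.step, hψ] using ⟨h1, h2⟩

/-- A character is a candidate as soon as `N` rounds have read it off from a selected coset. -/
theorem mem_candidates {p r n d : ℕ} [Fact p.Prime] {N : ℕ} (hN : 0 < N)
    (H : Fin n → Submodule (ZMod p) (Vec p r))
    (x : Fin n → Fin d → Vec p r) (s : Gamma2 H x → ℂ)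
    (sel : (j : Fin n) → List (AddChar (H j) ℂ)) (χ : AddChar (Vec p r) ℂ) (J : Finset (Fin n))
    (hJ : N ≤ J.card) (h : ∀ j ∈ J, ∃ ψ ∈ sel j, identify H x s j ψ = χ) :
    χ ∈ candidates N H x s sel := by
  classical
  have hfold : candidates N H x s sel = (((List.finRange n).flatMap fun j =>
      (sel j).map (identify H x s j)).foldl (fun S ψ => S.step N ψ)
        (⟨fun _ => 0, []⟩ : LoopState (AddChar (Vec p r) ℂ))).Z := by
    rw [List.foldl_flatMap]
    simp only [List.foldl_map]
    rfl
  rw [hfold]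
  refine mem_foldl_step N χ _ _ (Or.inr ⟨hN, ?_⟩)
  rw [zero_add, List.count_flatMap]
  have hsum : (List.map (List.count χ ∘ fun j => (sel j).map (identify H x s j))
      (List.finRange n)).sum = ∑ j, ((sel j).map (identify H x s j)).count χ := by
    rw [← List.sum_ofFn, List.ofFn_eq_map]
    rfl
  rw [hsum]
  calc N ≤ J.card := hJ
    _ = ∑ j ∈ J, 1 := by simp
    _ ≤ ∑ j ∈ J, ((sel j).map (identify H x s j)).count χ := by
        refine Finset.sum_le_sum fun j hj => List.one_le_count_iff.2 (List.mem_map.2 ?_)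
        obtain ⟨ψ, hψ, hχ⟩ := h j hj
        exact ⟨ψ, hψ, hχ⟩
    _ ≤ _ := Finset.sum_le_univ_sum_of_nonneg fun _ => Nat.zero_le _

/-! ### Medians -/

theorem le_getElem_of_countP_lt_le {S : List ℝ} (hS : S.Pairwise (· ≤ ·)) {i : ℕ}
    (hi : i < S.length) {a : ℝ} (h : S.countP (fun y => decide (y < a)) ≤ i) : a ≤ S[i] := by
  by_contra! hc
  have h1 : (S.take (i + 1)).countP (fun y => decide (y < a)) = (S.take (i + 1)).length := by
    rw [List.countP_eq_length]
    intro y hy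
    obtain ⟨k, hk, rfl⟩ := List.mem_iff_getElem.1 hy
    rw [List.length_take] at hk
    rw [List.getElem_take]
    have : S[k] ≤ S[i] := hS.rel_get_of_le (a := ⟨k, by omega⟩) (b := ⟨i, hi⟩) (by simp; omega)
    simpa using this.trans_lt hc
  have h2 := (List.take_sublist (i + 1) S).countP_le (p := fun y => decide (y < a))
  rw [h1, List.length_take] at h2
  omega

theorem getElem_le_of_countP_gt_lt {S : List ℝ} (hS : S.Pairwise (· ≤ ·)) {i : ℕ}
    (hi : i < S.length) {a : ℝ} (h : S.countP (fun y => decide (a < y)) < S.length - i) :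
    S[i] ≤ a := by
  by_contra! hc
  have h1 : (S.drop i).countP (fun y => decide (a < y)) = (S.drop i).length := by
    rw [List.countP_eq_length]
    intro y hy
    obtain ⟨k, hk, rfl⟩ := List.mem_iff_getElem.1 hy
    rw [List.length_drop] at hk
    rw [List.getElem_drop]
    have : S[i] ≤ S[i + k] :=
      hS.rel_get_of_le (a := ⟨i, hi⟩) (b := ⟨i + k, by omega⟩) (by simp)
    simpa using hc.trans_le this
  have h2 := (List.drop_sublist i S).countP_le (p := fun y => decide (a < y))
  rw [h1, List.length_drop] at h2
  omega

/-- The median is as close to `c` as more than half of the entries are. -/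
theorem abs_median_sub_le {L : List ℝ} {c B : ℝ}
    (h : 2 * L.countP (fun y => decide (B < |y - c|)) < L.length) : |median L - c| ≤ B := by
  set S := L.insertionSort (· ≤ ·) with hS
  have hperm : S.Perm L := List.perm_insertionSort _ _
  have hpw : S.Pairwise (· ≤ ·) := List.pairwise_insertionSort _ _
  have hcount := hperm.countP_eq (fun y => decide (B < |y - c|))
  have hlen := hperm.length_eq
  have hlow : S.countP (fun y => decide (y < c - B)) ≤
      S.countP (fun y => decide (B < |y - c|)) :=
    List.countP_mono_left fun y _ hy => by
      simp only [decide_eq_true_eq] at *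
      rw [lt_abs]
      right; linarith
  have hhigh : S.countP (fun y => decide (c + B < y)) ≤
      S.countP (fun y => decide (B < |y - c|)) :=
    List.countP_mono_left fun y _ hy => by
      simp only [decide_eq_true_eq] at *
      rw [lt_abs]
      left; linarith
  have hi₁ : (S.length - 1) / 2 < S.length := by omega
  have hi₂ : S.length / 2 < S.length := by omega
  have hmed : median L = (S[(S.length - 1) / 2] + S[S.length / 2]) / 2 := by
    rw [← List.getD_eq_getElem S 0 hi₁, ← List.getD_eq_getElem S 0 hi₂]
    unfold median
    congr!
  have a₁ := le_getElem_of_countP_lt_le hpw hi₁ (a := c - B) (by omega)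
  have a₂ := le_getElem_of_countP_lt_le hpw hi₂ (a := c - B) (by omega)
  have b₁ := getElem_le_of_countP_gt_lt hpw hi₁ (a := c + B) (by omega)
  have b₂ := getElem_le_of_countP_gt_lt hpw hi₂ (a := c + B) (by omega)
  rw [hmed, abs_le]
  constructor <;> linarith

/-- Coordinatewise medians of complex numbers, more than half of which are within `B` of `c`. -/
theorem norm_median_sub_le {n : ℕ} (y : Fin n → ℂ) (c : ℂ) {B : ℝ}
    (J : Finset (Fin n)) (hJ : 2 * J.card < n) (h : ∀ j ∉ J, ‖y j - c‖ ≤ B) :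
    ‖((median (((List.finRange n).map y).map Complex.re) : ℂ) +
      Complex.I * (median (((List.finRange n).map y).map Complex.im) : ℂ)) - c‖ ≤ √2 * B := by
  have hcount : ∀ (F : ℂ → ℝ) (e : ℝ), (∀ j ∉ J, |F (y j) - e| ≤ B) →
      |median (((List.finRange n).map y).map F) - e| ≤ B := by
    intro F e hF
    refine abs_median_sub_le ?_
    rw [List.map_map, List.countP_map, List.length_map, List.length_finRange,
      List.countP_eq_length_filter]
    refine lt_of_le_of_lt (Nat.mul_le_mul_left 2 ?_) hJ
    rw [← List.toFinset_card_of_nodup ((List.nodup_finRange n).filter _)]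
    refine Finset.card_le_card fun j hj => ?_
    by_contra hjJ
    simp only [List.toFinset_filter, Finset.mem_filter, Function.comp, decide_eq_true_eq] at hj
    exact absurd (hF j hjJ) (not_le.2 hj.2)
  have hre := hcount Complex.re c.re fun j hj =>
    (by simpa using Complex.abs_re_le_norm (y j - c) : _ ≤ _).trans (h j hj)
  have him := hcount Complex.im c.im fun j hj =>
    (by simpa using Complex.abs_im_le_norm (y j - c) : _ ≤ _).trans (h j hj)
  refine (Complex.norm_le_sqrt_two_mul_max _).trans ?_
  gcongr
  refine max_le ?_ ?_
  · simpa using hre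
  · simpa using him

/-! ### Fourier transforms on cosets of a subspace -/

/-- Fourier inversion. -/
theorem sum_fourier_mul {G : Type*} [AddCommGroup G] [Fintype G] (f : G → ℂ) (v : G) :
    ∑ χ : AddChar G ℂ, fourier f χ * χ v = f v := by
  classical
  have h1 : ∀ χ : AddChar G ℂ, fourier f χ * χ v =
      (Fintype.card G : ℂ)⁻¹ * ∑ x, f x * χ (v - x) := by
    intro χ
    simp only [fourier, mul_assoc, Finset.sum_mul, sub_eq_add_neg, AddChar.map_add_eq_mul,
      AddChar.map_neg_eq_inv]
    congr 1
    exact Finset.sum_congr rfl fun x _ => by ring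
  simp_rw [h1]
  rw [← Finset.mul_sum, Finset.sum_comm]
  simp_rw [← Finset.mul_sum, AddChar.sum_apply_eq_ite, sub_eq_zero]
  have hcard : (Fintype.card G : ℂ) ≠ 0 := by simp
  simp only [mul_ite, mul_zero, Finset.sum_ite_eq, Finset.mem_univ, if_true]
  field_simp

theorem fourier_addChar {G : Type*} [AddCommGroup G] [Fintype G] [DecidableEq (AddChar G ℂ)]
    (χ ψ : AddChar G ℂ) : fourier (fun y => χ y) ψ = if χ = ψ then 1 else 0 := by
  classical
  have h1 : ∀ y, χ y * (ψ y)⁻¹ = (χ - ψ) y := fun y => by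
    rw [AddChar.sub_apply', div_eq_mul_inv]
  unfold fourier
  simp_rw [h1]
  rw [AddChar.sum_eq_ite]
  simp only [sub_eq_zero]
  split_ifs <;> simp

section

variable {p r n d : ℕ} [Fact p.Prime] (H : Fin n → Submodule (ZMod p) (Vec p r))
  (x : Fin n → Fin d → Vec p r)

open Classical in
/-- The Fourier coefficient of a shifted restriction to a subspace collects the coefficients of
the whole coset. -/
theorem coeff_eq_sum (f : Vec p r → ℂ) (j : Fin n) (v : shifts (x j)) (ψ : AddChar (H j) ℂ) :
    coeff H x (fun w => f w) j v ψ =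
      ∑ χ with restrict (H j) χ = ψ, fourier f χ * χ v := by
  have h1 : (fun y : H j => f ((v : Vec p r) + (y : Vec p r))) =
      fun y => ∑ χ, (fourier f χ * χ v) * restrict (H j) χ y := by
    funext y
    rw [← sum_fourier_mul f]
    refine Finset.sum_congr rfl fun χ _ => ?_
    rw [AddChar.map_add_eq_mul, mul_assoc]
    rfl
  unfold coeff
  dsimp only
  rw [h1, Finset.sum_filter]
  have h2 : ∀ χ : AddChar (Vec p r) ℂ, (if restrict (H j) χ = ψ then fourier f χ * χ v else 0) =
      (fourier f χ * χ v) * fourier (fun y => restrict (H j) χ y) ψ := by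
    intro χ
    rw [fourier_addChar]
    split_ifs <;> simp
  simp_rw [h2]
  simp only [fourier, Finset.mul_sum, Finset.sum_mul]
  rw [Finset.sum_comm]
  refine Finset.sum_congr rfl fun χ _ => Finset.sum_congr rfl fun y _ => ?_
  simp only [← Finset.mul_sum, ← Finset.sum_mul]
  ring

/-! ### Characters and generating subspaces -/

/-- The subspace on which two characters agree. -/
def agreeOn (χ χ' : AddChar (Vec p r) ℂ) : Submodule (ZMod p) (Vec p r) :=
  AddSubgroup.toZModSubmodule p (AddMonoidHom.eqLocus χ.toAddMonoidHom χ'.toAddMonoidHom)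

theorem mem_agreeOn {χ χ' : AddChar (Vec p r) ℂ} {v : Vec p r} :
    v ∈ agreeOn χ χ' ↔ χ v = χ' v := Iff.rfl

theorem eq_of_agreeOn_eq_top {χ χ' : AddChar (Vec p r) ℂ} (h : agreeOn χ χ' = ⊤) : χ = χ' := by
  ext v
  exact mem_agreeOn.1 (h ▸ Submodule.mem_top)

theorem le_agreeOn_iff {χ χ' : AddChar (Vec p r) ℂ} {U : Submodule (ZMod p) (Vec p r)} :
    U ≤ agreeOn χ χ' ↔ restrict U χ = restrict U χ' := by
  constructor
  · intro h
    ext y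
    exact mem_agreeOn.1 (h y.2)
  · intro h v hv
    exact mem_agreeOn.2 (DFunLike.congr_fun h (⟨v, hv⟩ : U))

/-- The characters of `𝔽_p` are the functions `a ↦ ω_p ^ (b a)`. -/
theorem exists_eq_stdAddChar_mul (φ : AddChar (ZMod p) ℂ) :
    ∃ b : ZMod p, ∀ a, φ a = ZMod.stdAddChar (b * a) := by
  obtain ⟨b, rfl⟩ := (AddChar.zmodAddEquiv (n := p)).surjective φ
  refine ⟨b, fun a => ?_⟩
  obtain ⟨b, rfl⟩ := ZMod.intCast_surjective b
  obtain ⟨a, rfl⟩ := ZMod.intCast_surjective a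
  have h1 : AddChar.zmodAddEquiv (b : ZMod p) (a : ZMod p) =
      ((AddChar.zmod p (b : ZMod p) (a : ZMod p) : Circle) : ℂ) := rfl
  rw [h1, AddChar.zmod_intCast, Circle.coe_exp,
    show (b : ZMod p) * a = ((b * a : ℤ) : ZMod p) from (Int.cast_mul b a).symm, ZMod.stdAddChar_coe]
  congr 1
  push_cast
  ring

theorem exists_apply_smul_eq (χ : AddChar (Vec p r) ℂ) (v : Vec p r) :
    ∃ b : ZMod p, ∀ a : ZMod p, χ (a • v) = ZMod.stdAddChar (b * a) :=
  exists_eq_stdAddChar_mul (χ.compAddMonoidHom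
    (LinearMap.toSpanSingleton (ZMod p) (Vec p r) v).toAddMonoidHom)

theorem reconstruct_eq {U : Submodule (ZMod p) (Vec p r)} {y : Fin d → Vec p r}
    (hy : U ⊔ Submodule.span (ZMod p) (Set.range y) = ⊤) (χ : AddChar (Vec p r) ℂ)
    {b : Fin d → ZMod p} (hb : ∀ l a, χ (a • y l) = ZMod.stdAddChar (b l * a)) :
    reconstruct U y (restrict U χ) b = χ := by
  have hex : ∃ χ' : AddChar (Vec p r) ℂ, restrict U χ' = restrict U χ ∧
      ∀ (l : Fin d) (a : ZMod p), χ' (a • y l) = ZMod.stdAddChar (b l * a) := ⟨χ, rfl, hb⟩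
  obtain ⟨h1, h2⟩ := Classical.epsilon_spec hex
  refine eq_of_agreeOn_eq_top (top_le_iff.1 (hy ▸ sup_le (le_agreeOn_iff.2 h1) ?_))
  rw [Submodule.span_le]
  rintro _ ⟨l, rfl⟩
  have := (h2 l 1).trans (hb l 1).symm
  rw [one_smul] at this
  exact mem_agreeOn.2 this

variable {H} {m : ℕ}

open Classical in
/-- Distinct characters agree on fewer than `m` of the subspaces, since `m` of them span. -/
theorem IsGenerating.card_restrict_eq_le (hH : IsGenerating m H)
    {χ χ' : AddChar (Vec p r) ℂ} (hne : χ ≠ χ') :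
    (Finset.univ.filter fun j => restrict (H j) χ = restrict (H j) χ').card ≤ m - 1 := by
  by_contra! hc
  obtain ⟨I, hI, hcard⟩ := Finset.exists_subset_card_eq (n := m)
    (s := Finset.univ.filter fun j => restrict (H j) χ = restrict (H j) χ') (by omega)
  refine hne (eq_of_agreeOn_eq_top (top_le_iff.1 ?_))
  rw [← hH I hcard]
  refine iSup₂_le fun i hi => le_agreeOn_iff.2 ?_
  simpa using hI hi

theorem finrank_biSup_le {h : ℕ} (hdim : ∀ i, Module.finrank (ZMod p) (H i) = h)
    (I : Finset (Fin n)) : Module.finrank (ZMod p) (⨆ i ∈ I, H i : Submodule _ _) ≤ I.card * h := by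
  classical
  induction I using Finset.induction_on with
  | empty => simp
  | insert i I hi ih =>
    rw [Finset.iSup_insert, Finset.card_insert_of_notMem hi, add_mul, one_mul, add_comm, ← hdim i]
    rw [← hdim i] at ih
    exact (Submodule.finrank_add_le_finrank_add_finrank _ _).trans (by omega)

/-- Since `m ≤ n`, there are `m` of the subspaces to choose; they span, so `r ≤ m h`. -/
theorem IsGenerating.ceil_le (hH : IsGenerating m H) {h : ℕ} (hh : 1 ≤ h) (hmn : m ≤ n)
    (hdim : ∀ i, Module.finrank (ZMod p) (H i) = h) : ⌈(r : ℚ) / (h : ℚ)⌉₊ ≤ m := by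
  obtain ⟨I, -, hI⟩ := Finset.exists_subset_card_eq (n := m) (s := (Finset.univ : Finset (Fin n)))
    (by simpa using hmn)
  have h1 := finrank_biSup_le hdim I
  rw [hH I hI, hI, finrank_top, Module.finrank_fin_fun] at h1
  rw [Nat.ceil_le, div_le_iff₀ (by exact_mod_cast hh)]
  exact_mod_cast h1

end

/-! ### Collisions and noise in the cosets of a character -/

section

variable {p r n d : ℕ} [Fact p.Prime] (H : Fin n → Submodule (ZMod p) (Vec p r))
  (S : Finset (AddChar (Vec p r) ℂ)) (F : AddChar (Vec p r) ℂ → ℂ)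

open Classical in
/-- The `ℓ¹`-mass of `F` off `S`. -/
def tailMass : ℝ := ∑ χ with χ ∉ S, ‖F χ‖

open Classical in
/-- The `ℓ¹`-mass of `F` off `S` on the coset of `χ` modulo `H_j^⊥`, the term of `χ` left out. -/
def noise (j : Fin n) (χ : AddChar (Vec p r) ℂ) : ℝ :=
  ∑ χ' with χ' ∉ S ∧ χ' ≠ χ ∧ restrict (H j) χ = restrict (H j) χ', ‖F χ'‖

open Classical in
/-- The rounds `j` in which the coset of `χ` contains another element of `S`, or noise above
the level `c`. -/
def badRounds (c : ℝ) (χ : AddChar (Vec p r) ℂ) : Finset (Fin n) :=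
  Finset.univ.filter fun j =>
    (∃ χ' ∈ S.erase χ, restrict (H j) χ = restrict (H j) χ') ∨ c < noise H S F j χ

theorem tailMass_nonneg : 0 ≤ tailMass S F := Finset.sum_nonneg fun _ _ => norm_nonneg _

theorem noise_nonneg (j : Fin n) (χ : AddChar (Vec p r) ℂ) : 0 ≤ noise H S F j χ :=
  Finset.sum_nonneg fun _ _ => norm_nonneg _

variable {H} {m : ℕ}

/-- Every `χ' ≠ χ` shares fewer than `m` cosets with `χ`, so the total noise is controlled. -/
theorem sum_noise_le (hH : IsGenerating m H) (χ : AddChar (Vec p r) ℂ) :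
    ∑ j, noise H S F j χ ≤ (m - 1 : ℕ) * tailMass S F := by
  classical
  simp only [noise, tailMass, Finset.sum_filter, Finset.mul_sum]
  rw [Finset.sum_comm]
  refine Finset.sum_le_sum fun χ' _ => ?_
  by_cases hS : χ' ∈ S
  · simp [hS]
  by_cases hχ : χ' = χ
  · simp [hχ]
    split_ifs <;> positivity
  simp only [hS, hχ, not_false_eq_true, ne_eq, true_and, if_true]
  rw [← Finset.sum_filter, Finset.sum_const, nsmul_eq_mul]
  gcongr
  exact hH.card_restrict_eq_le (Ne.symm hχ)

/-- At the noise level `M / t`, `M` the tail mass, few rounds are bad: `t (m - 1)` bounds both the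
collisions with `S` and, by Markov's inequality, the rounds with much noise. -/
theorem card_badRounds_le (hH : IsGenerating m H) {t : ℕ} (hS : S.card ≤ t) {c : ℝ}
    (hc : tailMass S F ≤ t * c) (hc0 : 0 ≤ c) (χ : AddChar (Vec p r) ℂ) :
    (badRounds H S F c χ).card ≤ 2 * t * (m - 1) := by
  classical
  have h1 : ((S.erase χ).biUnion fun χ' => Finset.univ.filter fun j =>
      restrict (H j) χ = restrict (H j) χ').card ≤ t * (m - 1) := by
    refine Finset.card_biUnion_le.trans ?_
    calc _ ≤ ∑ χ' ∈ S.erase χ, (m - 1) := Finset.sum_le_sum fun χ' hχ' =>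
            hH.card_restrict_eq_le (Finset.ne_of_mem_erase hχ').symm
      _ = (S.erase χ).card * (m - 1) := by simp
      _ ≤ t * (m - 1) := by
        gcongr
        exact (Finset.card_le_card (Finset.erase_subset _ _)).trans hS
  have h2 : (Finset.univ.filter fun j => c < noise H S F j χ).card ≤ t * (m - 1) := by
    set J := Finset.univ.filter fun j => c < noise H S F j χ with hJ
    rcases J.eq_empty_or_nonempty with he | hne
    · simp [he]
    by_contra! hcard
    have h3 : (J.card : ℝ) * c < (m - 1 : ℕ) * (t * c) := by
      calc (J.card : ℝ) * c = ∑ j ∈ J, c := by simp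
        _ < ∑ j ∈ J, noise H S F j χ :=
          Finset.sum_lt_sum_of_nonempty hne fun j hj => (Finset.mem_filter.1 hj).2
        _ ≤ ∑ j, noise H S F j χ :=
          Finset.sum_le_univ_sum_of_nonneg fun j => noise_nonneg H S F j χ
        _ ≤ (m - 1 : ℕ) * tailMass S F := sum_noise_le S F hH χ
        _ ≤ _ := by gcongr
    have h4 : ((t * (m - 1) : ℕ) : ℝ) * c ≤ J.card * c := by gcongr
    push_cast at h4
    nlinarith
  have hsub : badRounds H S F c χ ⊆ ((S.erase χ).biUnion fun χ' => Finset.univ.filter fun j =>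
      restrict (H j) χ = restrict (H j) χ') ∪ Finset.univ.filter fun j => c < noise H S F j χ := by
    intro j hj
    simpa [badRounds] using hj
  calc _ ≤ _ := Finset.card_le_card hsub
    _ ≤ _ := Finset.card_union_le _ _
    _ ≤ t * (m - 1) + t * (m - 1) := by gcongr
    _ = _ := by ring

variable {S F} {c : ℝ} {χ : AddChar (Vec p r) ℂ} {j : Fin n}

theorem noise_le_of_notMem_badRounds (hj : j ∉ badRounds H S F c χ) : noise H S F j χ ≤ c := by
  simp only [badRounds, Finset.mem_filter, Finset.mem_univ, true_and, not_or, not_lt] at hj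
  exact hj.2

theorem restrict_ne_of_notMem_badRounds (hj : j ∉ badRounds H S F c χ)
    {χ' : AddChar (Vec p r) ℂ} (hχ' : χ' ∈ S) (hne : χ' ≠ χ) :
    restrict (H j) χ ≠ restrict (H j) χ' := by
  simp only [badRounds, Finset.mem_filter, Finset.mem_univ, true_and, not_or, not_exists,
    not_and] at hj
  exact hj.1 χ' (Finset.mem_erase.2 ⟨hne, hχ'⟩)

/-! ### Accuracy in the good rounds -/

variable (x : Fin n → Fin d → Vec p r) {f : Vec p r → ℂ}

theorem norm_coeff_sub_le (hj : j ∉ badRounds H S (fourier f) c χ) (v : shifts (x j)) :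
    ‖coeff H x (fun w => f w) j v (restrict (H j) χ) - fourier f χ * χ v‖ ≤ c := by
  classical
  refine le_trans ?_ (noise_le_of_notMem_badRounds hj)
  rw [coeff_eq_sum, ← Finset.add_sum_erase _ _ (by simp : χ ∈ Finset.univ.filter fun χ' =>
    restrict (H j) χ' = restrict (H j) χ), add_sub_cancel_left]
  refine (norm_sum_le _ _).trans ?_
  have h1 : ∀ χ' : AddChar (Vec p r) ℂ, ‖fourier f χ' * χ' v‖ = ‖fourier f χ'‖ := fun χ' => by
    rw [norm_mul, AddChar.norm_apply, mul_one]
  simp_rw [h1]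
  refine Finset.sum_le_sum_of_subset_of_nonneg (fun χ' hχ' => ?_) fun _ _ _ => norm_nonneg _
  simp only [Finset.mem_erase, Finset.mem_filter, Finset.mem_univ, true_and] at hχ' ⊢
  exact ⟨fun hS => restrict_ne_of_notMem_badRounds hj hS hχ'.1 hχ'.2.symm, hχ'.1, hχ'.2.symm⟩

theorem norm_coeffZero_sub_le (hj : j ∉ badRounds H S (fourier f) c χ) :
    ‖coeffZero H x (fun w => f w) j (restrict (H j) χ) - fourier f χ‖ ≤ c := by
  simpa [coeffZero] using norm_coeff_sub_le x hj ⟨0, zero_mem_shifts (x j)⟩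

theorem norm_estimate_sub_le (hcard : 2 * (badRounds H S (fourier f) c χ).card < n) :
    ‖estimate H x (fun w => f w) χ - fourier f χ‖ ≤ √2 * c :=
  norm_median_sub_le _ _ _ hcard fun _ hj => norm_coeffZero_sub_le x hj

/-- In a good round a large coefficient is read off correctly: the samples of the 1-sparse procedure
are off by at most `c < ‖f̂ χ‖ / 2`. -/
theorem identify_eq (hx : ∀ i, H i ⊔ Submodule.span (ZMod p) (Set.range (x i)) = ⊤)
    (hj : j ∉ badRounds H S (fourier f) c χ) (hχ : 2 * c < ‖fourier f χ‖) :
    identify H x (fun w => f w) j (restrict (H j) χ) = χ := by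
  choose b hb using fun l => exists_apply_smul_eq χ (x j l)
  unfold identify
  have h1 : ∀ l, oneSparse (fun a : sampleK p => coeff H x (fun w => f w) j
      ⟨(a : ZMod p) • x j l, smul_mem_shifts (x j) a l⟩ (restrict (H j) χ)) = b l := by
    intro l
    refine oneSparse_eq_of_near _ (fourier f χ) (b l) fun k => ?_
    rw [← hb]
    exact (norm_coeff_sub_le x hj _).trans_lt (by linarith)
  simp_rw [h1]
  exact reconstruct_eq (hx j) χ hb

/-- A coset of a large coefficient is selected in every good round: otherwise at least `t` cosets
free of `S` would carry a noise of at least `‖f̂ χ‖ - c > c` each, which exceeds the tail mass. -/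
theorem restrict_mem_of_isLargest {t : ℕ} (ht : 1 ≤ t) (hS : S.card ≤ t) (hχS : χ ∈ S)
    (hc : tailMass S (fourier f) ≤ t * c)
    (hj : j ∉ badRounds H S (fourier f) c χ) (hχ : 2 * c < ‖fourier f χ‖)
    {L : List (AddChar (H j) ℂ)}
    (hL : IsLargest (2 * t - 1) (fun ψ => ‖coeffZero H x (fun w => f w) j ψ‖) L) :
    restrict (H j) χ ∈ L := by
  classical
  by_contra hnot
  have hlen := hL.length_eq_of_notMem hnot
  set U := L.toFinset \ (S.erase χ).image (restrict (H j)) with hU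
  have hUcard : t ≤ U.card := by
    have h1 := Finset.le_card_sdiff ((S.erase χ).image (restrict (H j))) L.toFinset
    have h2 : ((S.erase χ).image (restrict (H j))).card ≤ S.card - 1 :=
      Finset.card_image_le.trans (Finset.card_erase_of_mem hχS).le
    rw [List.toFinset_card_of_nodup hL.1, hlen, ← hU] at h1
    omega
  have hUne : U.Nonempty := Finset.card_pos.1 (by omega)
  have hc0 : 0 ≤ c := (noise_nonneg H S _ j χ).trans (noise_le_of_notMem_badRounds hj)
  have hlow : ∀ ψ ∈ U, c < ∑ χ' with χ' ∉ S ∧ restrict (H j) χ' = ψ, ‖fourier f χ'‖ := by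
    intro ψ hψ
    rw [hU, Finset.mem_sdiff, List.mem_toFinset] at hψ
    have h1 : ‖coeffZero H x (fun w => f w) j (restrict (H j) χ)‖ ≤
      ‖coeffZero H x (fun w => f w) j ψ‖ := hL.2.2 ψ hψ.1 _ hnot
    have h2 := norm_coeffZero_sub_le x hj
    have h3 := norm_sub_norm_le (fourier f χ) (coeffZero H x (fun w => f w) j (restrict (H j) χ))
    rw [norm_sub_rev] at h3
    refine lt_of_lt_of_le (by linarith : c < ‖coeffZero H x (fun w => f w) j ψ‖) ?_
    unfold coeffZero
    rw [coeff_eq_sum]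
    refine (norm_sum_le _ _).trans ?_
    simp only [AddChar.map_zero_eq_one, mul_one]
    refine Finset.sum_le_sum_of_subset_of_nonneg (fun χ' hχ' => ?_) fun _ _ _ => norm_nonneg _
    simp only [Finset.mem_filter, Finset.mem_univ, true_and] at hχ' ⊢
    refine ⟨fun hS' => hψ.2 (Finset.mem_image.2 ⟨χ', Finset.mem_erase.2 ⟨?_, hS'⟩, hχ'⟩), hχ'⟩
    rintro rfl
    exact hnot (hχ' ▸ hψ.1)
  have hsum : ∑ ψ ∈ U, ∑ χ' with χ' ∉ S ∧ restrict (H j) χ' = ψ, ‖fourier f χ'‖ ≤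
      tailMass S (fourier f) := by
    calc _ ≤ ∑ ψ, ∑ χ' with χ' ∉ S ∧ restrict (H j) χ' = ψ, ‖fourier f χ'‖ :=
          Finset.sum_le_univ_sum_of_nonneg fun ψ => Finset.sum_nonneg fun _ _ => norm_nonneg _
      _ = _ := by
          simp_rw [← Finset.filter_filter]
          exact Finset.sum_fiberwise _ _ _
  have hlt : ∑ ψ ∈ U, c < ∑ ψ ∈ U, ∑ χ' with χ' ∉ S ∧ restrict (H j) χ' = ψ, ‖fourier f χ'‖ :=
    Finset.sum_lt_sum_of_nonempty hUne hlow
  rw [Finset.sum_const, nsmul_eq_mul] at hlt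
  have : (t : ℝ) * c ≤ U.card * c := by gcongr
  linarith

end

/-! ### The final selection -/

/-- Keeping the `t` largest values of an approximation `F₂` of `F` has an `ℓ¹`-error of at most
`3 t B` plus the mass of `F` off `S`.  A dropped `χ ∈ S` is played off against a kept `χ' ∉ S`, whose value
under `F₂` is at least as large; `τ` is the largest loss at a dropped element of `S`. -/
theorem sum_norm_sub_keep_le {X : Type*} [Fintype X] [DecidableEq X] {t : ℕ} (F F₂ : X → ℂ)
    (S : Finset X) (hS : S.card ≤ t) {B : ℝ} (hB : 0 ≤ B)
    (h : ∀ χ, ‖F₂ χ - F χ‖ ≤ B ∨ F₂ χ = 0 ∧ (χ ∈ S → ‖F χ‖ ≤ 2 * B))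
    (T : List X) (hT : IsLargest t (fun χ => ‖F₂ χ‖) T) :
    ∑ χ, ‖F χ - keep T F₂ χ‖ ≤ (∑ χ with χ ∉ S, ‖F χ‖) + 3 * t * B := by
  classical
  have hTcard : T.toFinset.card = min t (Nat.card X) := by
    rw [List.toFinset_card_of_nodup hT.1, hT.2.1]
  have hTt : (T.toFinset.card : ℝ) ≤ t := by
    rw [hTcard]; exact_mod_cast min_le_left _ _
  have hST : S.card ≤ T.toFinset.card := by
    rw [hTcard, Nat.card_eq_fintype_card]
    exact le_min hS (Finset.card_le_univ S)
  have hdiff : ((S \ T.toFinset).card : ℝ) ≤ (T.toFinset \ S).card := by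
    have h1 := Finset.card_sdiff_add_card_inter S T.toFinset
    have h2 := Finset.card_sdiff_add_card_inter T.toFinset S
    rw [Finset.inter_comm] at h2
    exact_mod_cast (by omega : (S \ T.toFinset).card ≤ (T.toFinset \ S).card)
  have hpair : ∀ χ ∈ S, χ ∉ T → ∀ χ' ∈ T, χ' ∉ S →
      ‖F χ' - F₂ χ'‖ ≤ 3 * B + ‖F χ'‖ - ‖F χ‖ := by
    intro χ hχ hχT χ' hχ' hχS'
    have h1 : ‖F₂ χ‖ ≤ ‖F₂ χ'‖ := hT.2.2 χ' hχ' χ hχT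
    have a1 := norm_sub_norm_le (F χ) (F₂ χ)
    have a2 := norm_sub_norm_le (F₂ χ') (F χ')
    rw [norm_sub_rev] at a1
    have h2 := h χ
    rcases h χ' with h' | ⟨h', -⟩
    · rw [norm_sub_rev]
      rcases h2 with h2 | ⟨h2, h3⟩
      · linarith
      · have := h3 hχ
        linarith [norm_nonneg (F χ')]
    · rw [h', norm_zero] at h1
      rw [h', sub_zero]
      rcases h2 with h2 | ⟨h2, h3⟩
      · linarith
      · have := h3 hχ
        linarith
  have hkept : ∀ χ ∈ T, ‖F χ - F₂ χ‖ ≤ 3 * B + if χ ∉ S then ‖F χ‖ else 0 := by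
    intro χ _
    rcases h χ with h1 | ⟨h1, h2⟩
    · rw [norm_sub_rev]
      split_ifs <;> linarith [norm_nonneg (F χ)]
    · rw [h1, sub_zero]
      split_ifs with hs
      · linarith [h2 hs]
      · linarith
  obtain ⟨τ, hτ0, hτ1, hτ2⟩ : ∃ τ : ℝ, 0 ≤ τ ∧ (∀ χ ∈ S, χ ∉ T → ‖F χ‖ ≤ τ) ∧
      ∀ χ ∈ T, χ ∉ S → ‖F χ - F₂ χ‖ ≤ 3 * B + ‖F χ‖ - τ := by
    rcases (S \ T.toFinset).eq_empty_or_nonempty with he | hne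
    · refine ⟨0, le_rfl, fun χ hχ hχT => ?_, fun χ hχ hχS => ?_⟩
      · have : χ ∈ S \ T.toFinset := by simp [hχ, hχT]
        simp [he] at this
      · simpa [hχS] using hkept χ hχ
    · obtain ⟨χ₀, hχ₀, hmax⟩ := Finset.exists_max_image _ (fun χ => ‖F χ‖) hne
      simp only [Finset.mem_sdiff, List.mem_toFinset] at hχ₀ hmax
      exact ⟨‖F χ₀‖, norm_nonneg _, fun χ hχ hχT => hmax χ ⟨hχ, hχT⟩,
        hpair χ₀ hχ₀.1 hχ₀.2⟩
  have hpoint : ∀ χ, ‖F χ - keep T F₂ χ‖ ≤ (if χ ∉ S then ‖F χ‖ else 0) +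
      (if χ ∈ T.toFinset then 3 * B else 0) + (if χ ∈ S \ T.toFinset then τ else 0) -
      (if χ ∈ T.toFinset \ S then τ else 0) := by
    intro χ
    by_cases hχT : χ ∈ T <;> by_cases hχS : χ ∈ S
    · simpa [keep, hχT, hχS] using hkept χ hχT
    · have := hτ2 χ hχT hχS
      simp only [keep, hχT, hχS, Finset.mem_sdiff, List.mem_toFinset, if_true, not_false_eq_true,
        false_and, if_false, and_self]
      linarith
    · simpa [keep, hχT, hχS] using hτ1 χ hχS hχT
    · simp [keep, hχT, hχS]
  refine (Finset.sum_le_sum fun χ _ => hpoint χ).trans ?_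
  rw [Finset.sum_sub_distrib, Finset.sum_add_distrib, Finset.sum_add_distrib, ← Finset.sum_filter,
    Finset.sum_ite_mem, Finset.sum_ite_mem, Finset.sum_ite_mem, Finset.univ_inter,
    Finset.univ_inter, Finset.univ_inter]
  simp only [Finset.sum_const, nsmul_eq_mul]
  have e1 := mul_le_mul_of_nonneg_right hdiff hτ0
  have e2 := mul_le_mul_of_nonneg_right hTt (by positivity : 0 ≤ 3 * B)
  linarith

end FourierSampling

end

theorem theorem9 (p r t m n h : ℕ) [Fact p.Prime]
    (ht : 1 ≤ t) (hm : 1 ≤ m) (hn : n = 4 * t * (m - 1) + 1) (hh : 1 ≤ h) (hhr : h ≤ r)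
    (H : Fin n → Submodule (ZMod p) (FourierSampling.Vec p r))
    (hH : FourierSampling.IsGenerating m H)
    (hdim : ∀ i, Module.finrank (ZMod p) (H i) = h)
    (x : Fin n → Fin (r - h) → FourierSampling.Vec p r)
    (hx : ∀ i, H i ⊔ Submodule.span (ZMod p) (Set.range (x i)) = ⊤)
    (f : FourierSampling.Vec p r → ℂ) :
    (∃ F, FourierSampling.IsOutput t h H x (fun v => f v) F) ∧
    ∀ F, FourierSampling.IsOutput t h H x (fun v => f v) F →
      (Function.support F).ncard ≤ t ∧
      ∀ g ε : AddChar (FourierSampling.Vec p r) ℂ → ℂ,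
        (Function.support g).ncard ≤ t → FourierSampling.fourier f = g + ε →
        ∑ χ, ‖FourierSampling.fourier f χ - F χ‖ ≤ (1 + 3 * √2) * ∑ χ, ‖ε χ‖ := by
  open FourierSampling in
  classical
  refine ⟨?_, ?_⟩
  · choose sel hsel using fun j => exists_isLargest (2 * t - 1)
      (fun ψ : AddChar (H j) ℂ => ‖coeffZero H x (fun v => f v) j ψ‖)
    obtain ⟨T, hT⟩ := exists_isLargest t fun χ => ‖keep
      (candidates (2 * t * (⌈(r : ℚ) / (h : ℚ)⌉₊ - 1) + 1) H x (fun v => f v) sel)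
      (estimate H x (fun v => f v)) χ‖
    exact ⟨_, sel, hsel, _, rfl, T, hT, rfl⟩
  rintro F ⟨sel, hsel, F₂, hF₂, T, hT, rfl⟩
  refine ⟨?_, fun g ε hg hgε => ?_⟩
  · have hsub : Function.support (keep T F₂) ⊆ T.toFinset := by
      intro χ hχ
      by_contra hχT
      exact hχ (if_neg (by simpa using hχT))
    refine (Set.ncard_le_ncard hsub (Finset.finite_toSet _)).trans ?_
    rw [Set.ncard_coe_finset, List.toFinset_card_of_nodup hT.1, hT.2.1]
    exact min_le_left _ _
  -- On `S` nothing of `ε` is used, so that `ε` may as well vanish there.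
  set S := (Function.support g).toFinset with hSdef
  have hS : S.card ≤ t := by rwa [hSdef, ← Set.ncard_eq_toFinset_card']
  set M := tailMass S (fourier f) with hM
  have hM0 : 0 ≤ M := tailMass_nonneg _ _
  have hMε : M ≤ ∑ χ, ‖ε χ‖ := by
    calc M = ∑ χ with χ ∉ S, ‖ε χ‖ := Finset.sum_congr rfl fun χ hχ => by
          have : g χ = 0 := by simpa [hSdef] using hχ
          rw [hgε, Pi.add_apply, this, zero_add]
      _ ≤ _ := Finset.sum_le_univ_sum_of_nonneg fun _ => norm_nonneg _
  have ht0 : (0 : ℝ) < t := by exact_mod_cast ht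
  have hc0 : 0 ≤ M / t := by positivity
  have hc : M ≤ t * (M / t) := by rw [mul_div_cancel₀ _ ht0.ne']
  have hbad := card_badRounds_le S (fourier f) hH hS hc hc0
  have hsqrt : 1 ≤ √2 := Real.one_le_sqrt.2 one_le_two
  have hn' : n = 2 * (2 * t * (m - 1)) + 1 := by rw [hn]; ring
  have hmn : m ≤ n := by
    obtain ⟨m, rfl⟩ := Nat.exists_eq_add_of_le' hm
    simp only [Nat.add_sub_cancel] at hn
    nlinarith
  have happrox : ∀ χ, ‖F₂ χ - fourier f χ‖ ≤ √2 * (M / t) ∨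
      F₂ χ = 0 ∧ (χ ∈ S → ‖fourier f χ‖ ≤ 2 * (√2 * (M / t))) := by
    intro χ
    by_cases hZ : χ ∈ candidates (2 * t * (⌈(r : ℚ) / (h : ℚ)⌉₊ - 1) + 1) H x (fun v => f v) sel
    · left
      rw [hF₂, keep, if_pos hZ]
      refine norm_estimate_sub_le (S := S) x ?_
      have := hbad χ
      omega
    -- A non-candidate in `S` is small, else all good rounds would have counted it.
    · refine Or.inr ⟨by rw [hF₂, keep, if_neg hZ], fun hχS => ?_⟩
      by_contra! hlarge
      have hlarge' : 2 * (M / t) < ‖fourier f χ‖ := by nlinarith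
      refine hZ (mem_candidates (Nat.succ_pos _) H x _ sel χ
        (badRounds H S (fourier f) (M / t) χ)ᶜ ?_ fun j hj => ?_)
      · rw [Finset.card_compl, Fintype.card_fin]
        have h1 := hbad χ
        have h2 := hH.ceil_le hh hmn hdim
        have h3 : 2 * t * (⌈(r : ℚ) / (h : ℚ)⌉₊ - 1) ≤ 2 * t * (m - 1) := by gcongr
        omega
      · rw [Finset.mem_compl] at hj
        exact ⟨_, restrict_mem_of_isLargest x ht hS hχS hc hj hlarge' (hsel j),
          identify_eq x hx hj hlarge'⟩
  calc ∑ χ, ‖fourier f χ - keep T F₂ χ‖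
      ≤ M + 3 * t * (√2 * (M / t)) :=
        sum_norm_sub_keep_le _ F₂ S hS (by positivity) happrox T hT
    _ = (1 + 3 * √2) * M := by field_simp
    _ ≤ _ := by gcongr
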